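/- Let $k\ge 1$ and let $H=([k],E,I)$ be a hypergraph on the vertex set $[k]=\{1,\dots,k\}$ with a finite edge set $E$ and incidence relation $I\subseteq[k]\times E$ (multiple edges are allowed). Write $E_j$ for the set of edges incident with the vertex $j$. Let $\mathrm{GHZ}^H$ be the (unnormalized) $k$-party state that is the product over $e\in E$ of two-level GHZ states shared by the parties incident with $e$, i.e. $$\mathrm{GHZ}^H=\sum_{i\in\{0,1\}^E}|(i_e)_{e\in E_1}\rangle\otimes\cdots\otimes|(i_e)_{e\in E_k}\rangle ,$$ where party $j$ holds the space $(\mathbb{C}^2)^{\otimes E_j}$, and let $\mathrm{GHZ}=|0\cdots0\rangle+|1\cdots1\rangle\in(\mathbb{C}^2)^{\otimes k}$. For $\psi\in V_1\otimes\cdots\otimes V_k$ and $\varphi\in W_1\otimes\cdots\otimes W_k$ (complex vector spaces) write $\psi\to\varphi$ if there are linear maps $A_j:V_j\to W_j$ with $(A_1\otimes\cdots\otimes A_k)\psi=\varphi$ (SLOCC convertibility). Regard $\psi^{\otimes m}$ as an element of $V_1^{\otimes m}\otimes\cdots\otimes V_k^{\otimes m}$, and define the asymptotic SLOCC conversion rate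 $$\omega(\psi,\varphi)=\lim_{n\to\infty}\frac1n\inf\{m\in\mathbb{N}\mid\psi^{\otimes m}\to\varphi^{\otimes n}\}\in[0,\infty],\qquad \inf\emptyset=\infty .$$ A hypergraph is connected if any two vertices $x,y$ are joined by a sequence $x=v_0,e_1,v_1,\dots,e_n,v_n=y$ ($n\ge0$) with $e_i$ incident with $v_{i-1}$ and $v_i$. It is $l$-edge-connected if it remains connected after removing any set of strictly less than $l$ edges. The edge-connectivity $\lambda(H)$ is the largest $l\in\mathbb{N}$ such that $H$ is $l$-edge-connected, and $\lambda(H)=\infty$ if there is no largest one (which happens only for $k=1$). Then the limit defining $\omega(\mathrm{GHZ}^H,\mathrm{GHZ})$ exists in $[0,\infty]$ and $$\omega(\mathrm{GHZ}^H,\mathrm{GHZ})=\frac1{\lambda(H)},$$ with the conventions $1/0=\infty$ (the case of a disconnected $H$) and $1/\infty=0$ (the case $k=1$). -/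

import Mathlib

open Filter Topology
open scoped TensorProduct ENNReal

/-- A hypergraph `(V, E, I)` with vertex set `V` and edge set `E`, given by its incidence relation
`I ⊆ V × E`. Different edges may be incident with the same vertices (multiple edges). -/
structure MultiHypergraph (V E : Type*) where
  /-- `Inc v e` says that the vertex `v` is incident with the edge `e`. -/
  Inc : V → E → Prop

namespace MultiHypergraph

variable {V E : Type*}

/-- Any two vertices `x`, `y` are joined by a sequence `x = v₀, e₁, v₁, …, eₙ, vₙ = y` (`n ≥ 0`)
in which `eᵢ` is incident with `vᵢ₋₁` and `vᵢ`. -/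
def Connected (H : MultiHypergraph V E) : Prop :=
  ∀ x y : V, Relation.ReflTransGen (fun u v => ∃ e : E, H.Inc u e ∧ H.Inc v e) x y

/-- The hypergraph obtained by removing the edges in `F`; all vertices are kept. -/
def deleteEdges (H : MultiHypergraph V E) (F : Set E) : MultiHypergraph V {e : E // e ∉ F} where
  Inc v e := H.Inc v e

/-- `H` remains connected after removing any set of strictly less than `l` edges. -/
def IsEdgeConnected (H : MultiHypergraph V E) (l : ℕ) : Prop :=
  ∀ F : Set E, F.encard < l → (H.deleteEdges F).Connected

/-- The edge-connectivity: the largest `l` such that `H` is `l`-edge-connected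
(`⊤` if there is no largest one, which for finitely many edges only happens when there is
at most one vertex). -/
noncomputable def edgeConnectivity (H : MultiHypergraph V E) : ℕ∞ :=
  ⨆ (l : ℕ) (_ : H.IsEdgeConnected l), (l : ℕ∞)

end MultiHypergraph

section Tensors

variable {ι : Type*} {V W : ι → Type*}
  [∀ i, AddCommGroup (V i)] [∀ i, Module ℂ (V i)]
  [∀ i, AddCommGroup (W i)] [∀ i, Module ℂ (W i)]

/-- `ψ` can be transformed into `φ` via SLOCC: there are linear maps `A i : V i → W i` with
`(⨂ i, A i) ψ = φ`. -/
def SLOCC (ψ : ⨂[ℂ] i, V i) (φ : ⨂[ℂ] i, W i) : Prop :=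
  ∃ A : ∀ i, V i →ₗ[ℂ] W i, PiTensorProduct.map A ψ = φ

/-- Appending a tensor factor: the bilinear map
`(v₁ ⊗ ⋯ ⊗ vₘ, v) ↦ v₁ ⊗ ⋯ ⊗ vₘ ⊗ v`. -/
noncomputable def tensorSnoc (M : Type*) [AddCommGroup M] [Module ℂ M] (m : ℕ) :
    ⨂[ℂ]^m M →ₗ[ℂ] M →ₗ[ℂ] ⨂[ℂ]^(m + 1) M :=
  ((TensorProduct.mk ℂ (⨂[ℂ]^m M) (⨂[ℂ]^1 M)).compr₂
      (TensorPower.mulEquiv (R := ℂ) (M := M) (n := m) (m := 1)).toLinearMap).compl₂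
    (PiTensorProduct.subsingletonEquiv (R := ℂ) (s := fun _ : Fin 1 => M) 0).symm.toLinearMap

/-- The tensor power `ψ^{⊗ m}` of a multipartite tensor, again regarded as a tensor shared by the
same parties: party `i` holds the `m` copies of its space, i.e. the space `(V i)^{⊗ m}`.
The products are formed party by party. -/
noncomputable def partyPow (ψ : ⨂[ℂ] i, V i) : (m : ℕ) → ⨂[ℂ] i, (⨂[ℂ]^m (V i))
  | 0 => PiTensorProduct.tprod ℂ fun _ => PiTensorProduct.tprod ℂ Fin.elim0
  | m + 1 => PiTensorProduct.map₂ (fun i => tensorSnoc (V i) m) (partyPow ψ m) ψ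

/-- `inf {m ∈ ℕ | ψ^{⊗ m} can be transformed into φ^{⊗ n} via SLOCC}`, which is `∞` if there is
no such `m`. -/
noncomputable def sloccCost (ψ : ⨂[ℂ] i, V i) (φ : ⨂[ℂ] i, W i) (n : ℕ) : ℝ≥0∞ :=
  ⨅ (m : ℕ) (_ : SLOCC (partyPow ψ m) (partyPow φ n)), (m : ℝ≥0∞)

/-- The asymptotic SLOCC conversion rate from `ψ` to `φ`, with values in `[0, ∞]`. -/
noncomputable def sloccRate (ψ : ⨂[ℂ] i, V i) (φ : ⨂[ℂ] i, W i) : ℝ≥0∞ :=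
  limUnder atTop fun n : ℕ => sloccCost ψ φ n / n

end Tensors

/-- The unnormalized `r`-level GHZ state `∑ a, |a⟩ ⊗ ⋯ ⊗ |a⟩` shared by all `k` parties. -/
noncomputable def ghz (k r : ℕ) : ⨂[ℂ] _ : Fin k, (Fin r → ℂ) :=
  ∑ a : Fin r, PiTensorProduct.tprod ℂ fun _ => Pi.single a 1

open Classical in
/-- The product over the edges `e` of `H` of the `r`-level GHZ states shared by the parties
incident with `e`. With one summation index `a e` for each edge this is
`∑ a, |(a e)_{e ∈ E₁}⟩ ⊗ ⋯ ⊗ |(a e)_{e ∈ Eₖ}⟩`, where `Eⱼ` is the set of edges incident with `j`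
and the computational basis of the space of party `j` is indexed by the functions `Eⱼ → Fin r`. -/
noncomputable def MultiHypergraph.ghzState {k : ℕ} {E : Type*} [Fintype E]
    (H : MultiHypergraph (Fin k) E) (r : ℕ) :
    ⨂[ℂ] j : Fin k, (({e : E // H.Inc j e} → Fin r) → ℂ) :=
  ∑ a : E → Fin r, PiTensorProduct.tprod ℂ fun j =>
    Pi.single (fun e : {e : E // H.Inc j e} => a e.1) (1 : ℂ)

/-! ### Tensor powers of sums of product vectors -/

section TensorSums

variable {ι : Type*} {V : ι → Type*} [∀ i, AddCommGroup (V i)] [∀ i, Module ℂ (V i)]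

theorem tensorSnoc_tprod (M : Type*) [AddCommGroup M] [Module ℂ M] (m : ℕ) (x : Fin m → M)
    (y : M) :
    tensorSnoc M m (PiTensorProduct.tprod ℂ x) y =
      PiTensorProduct.tprod ℂ (Fin.snoc x y : Fin (m + 1) → M) := by
  have h : (PiTensorProduct.subsingletonEquiv (R := ℂ) (s := fun _ : Fin 1 => M) 0).symm y =
      PiTensorProduct.tprod ℂ (fun _ : Fin 1 => y) := by
    rw [LinearEquiv.symm_apply_eq, PiTensorProduct.subsingletonEquiv_apply_tprod]
  simp only [tensorSnoc, LinearMap.compl₂_apply, LinearMap.compr₂_apply, LinearEquiv.coe_coe,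
    TensorProduct.mk_apply]
  rw [h, ← TensorPower.gMul_def, TensorPower.tprod_mul_tprod, Fin.append_right_eq_snoc]

/-- The tensor power of a scaled sum of product vectors. -/
theorem partyPow_smul_sum {A : Type*} [Fintype A] (c : ℂ) (v : ∀ i, A → V i) (m : ℕ) :
    partyPow (c • ∑ a, PiTensorProduct.tprod ℂ fun i => v i a) m =
      c ^ m • ∑ α : Fin m → A,
        PiTensorProduct.tprod ℂ fun i => PiTensorProduct.tprod ℂ fun l => v i (α l) := by
  induction m with
  | zero =>
    simp only [partyPow, pow_zero, one_smul, Fintype.sum_unique]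
    congr 1; funext i; congr 1; funext l; exact l.elim0
  | succ m ih =>
    rw [partyPow, ih, ← (Fin.snocEquiv fun _ => A).sum_comp, Fintype.sum_prod_type_right]
    simp only [map_smul, map_sum, LinearMap.smul_apply, LinearMap.sum_apply,
      PiTensorProduct.map₂_tprod_tprod, tensorSnoc_tprod]
    rw [← Finset.smul_sum, smul_smul, ← pow_succ', Finset.sum_comm]
    refine congrArg _ (Finset.sum_congr rfl fun α _ => Finset.sum_congr rfl fun a _ => ?_)
    congr 1; funext i; congr 1; funext l
    refine Fin.lastCases ?_ (fun l => ?_) l <;> simp [Fin.snocEquiv]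

end TensorSums

section BasisTensors

/-- The computational basis of a tensor power. -/
noncomputable def powBasis (B : Type*) [Finite B] (m : ℕ) :
    Module.Basis (Fin m → B) ℂ (⨂[ℂ]^m (B → ℂ)) :=
  Basis.piTensorProduct fun _ : Fin m => Pi.basisFun ℂ B

theorem powBasis_apply {B : Type*} [Finite B] (m : ℕ) (b : Fin m → B) :
    powBasis B m b = PiTensorProduct.tprod ℂ fun l => Pi.basisFun ℂ B (b l) := by
  rw [powBasis, Basis.piTensorProduct_apply]

theorem partyPow_smul_sum_basisFun {ι : Type*} {B : ι → Type*} [∀ i, Finite (B i)] {A : Type*}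
    [Fintype A] (c : ℂ) (r : ∀ i, A → B i) (m : ℕ) :
    partyPow (c • ∑ a, PiTensorProduct.tprod ℂ fun i => Pi.basisFun ℂ (B i) (r i a)) m =
      c ^ m • ∑ α : Fin m → A,
        PiTensorProduct.tprod ℂ fun i => powBasis (B i) m fun l => r i (α l) := by
  simp only [powBasis_apply]
  exact partyPow_smul_sum c (fun i a => Pi.basisFun ℂ (B i) (r i a)) m

theorem partyPow_sum_basisFun {ι : Type*} {B : ι → Type*} [∀ i, Finite (B i)] {A : Type*}
    [Fintype A] (r : ∀ i, A → B i) (m : ℕ) :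
    partyPow (∑ a, PiTensorProduct.tprod ℂ fun i => Pi.basisFun ℂ (B i) (r i a)) m =
      ∑ α : Fin m → A, PiTensorProduct.tprod ℂ fun i => powBasis (B i) m fun l => r i (α l) := by
  simpa using partyPow_smul_sum_basisFun (1 : ℂ) r m

end BasisTensors

/-! ### Diagonal sets and the conversions they give -/

/-- A set `S` of labels on which every `r j` is injective and which contains every label that no
party can distinguish from all the elements of `S`. -/
structure IsDiagonalSet {J A : Type*} {B : J → Type*} (r : ∀ j, A → B j) (S : Set A) : Prop where
  inj : ∀ j, Set.InjOn (r j) S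
  mem : ∀ a, (∀ j, ∃ s ∈ S, r j a = r j s) → a ∈ S

/-- Allows trimming a diagonal set to a power of two. One party already separates the elements of
`S`, hence excludes those outside `T`. -/
theorem IsDiagonalSet.subset {J A : Type*} [Nonempty J] {B : J → Type*} {r : ∀ j, A → B j}
    {S T : Set A} (hS : IsDiagonalSet r S) (hT : T ⊆ S) : IsDiagonalSet r T where
  inj j := (hS.inj j).mono hT
  mem a ha := by
    have haS : a ∈ S := hS.mem a fun j => (ha j).imp fun s hs => ⟨hT hs.1, hs.2⟩
    obtain ⟨s, hs, h⟩ := ha (Classical.arbitrary J)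
    rwa [hS.inj _ haS (hT hs) h]

theorem IsDiagonalSet.preimage {J A A' : Type*} {B B' : J → Type*} {r : ∀ j, A → B j}
    {r' : ∀ j, A' → B' j} {S : Set A} (hS : IsDiagonalSet r S) (e : A' ≃ A)
    (he : ∀ j x y, r j (e x) = r j (e y) ↔ r' j x = r' j y) : IsDiagonalSet r' (e ⁻¹' S) where
  inj j x hx y hy h := e.injective (hS.inj j hx hy ((he j x y).2 h))
  mem a ha := hS.mem _ fun j => by
    obtain ⟨s, hs, h⟩ := ha j
    exact ⟨e s, hs, (he j a s).2 h⟩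

section Conversion

variable {ι : Type*} [Fintype ι] [Nonempty ι] {B : ι → Type*} {W : ι → Type*}
  [∀ i, AddCommGroup (W i)] [∀ i, Module ℂ (W i)]

/-- A sum of product basis vectors can be converted into any sum of products of arbitrary vectors
indexed by the elements of a diagonal set. -/
theorem SLOCC.of_isDiagonalSet {A C : Type*} [Fintype A] [Fintype C] {V : ι → Type*}
    [∀ i, AddCommGroup (V i)] [∀ i, Module ℂ (V i)]
    (b : ∀ i, Module.Basis (B i) ℂ (V i)) (r : ∀ i, A → B i) {c : ℂ} (hc : c ≠ 0)
    (f : C → A) (hf : Function.Injective f) (hS : IsDiagonalSet r (Set.range f))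
    (w : ∀ i, C → W i) :
    SLOCC (c • ∑ a, PiTensorProduct.tprod ℂ fun i => b i (r i a))
      (∑ x, PiTensorProduct.tprod ℂ fun i => w i x) := by
  classical
  obtain ⟨i₀⟩ := ‹Nonempty ι›
  -- Basis vectors not occurring in the diagonal set go to 0, so every label outside it is killed by
  -- some party.
  set g : ∀ i, B i → W i := fun i y =>
    if h : ∃ x, r i (f x) = y then w i h.choose else 0 with hg
  have hgf : ∀ i x, g i (r i (f x)) = w i x := by
    intro i x
    have h : ∃ x', r i (f x') = r i (f x) := ⟨x, rfl⟩
    have h2 : h.choose = x := hf (hS.inj i ⟨_, rfl⟩ ⟨_, rfl⟩ h.choose_spec)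
    simp only [hg, dif_pos h, h2]
  have hg0 : ∀ a, a ∉ Set.range f → (PiTensorProduct.tprod ℂ fun i => g i (r i a)) = 0 := by
    intro a ha
    have : ∃ i, g i (r i a) = 0 := by
      by_contra! hne
      refine ha (hS.mem a fun i => ?_)
      by_contra! hcon
      refine hne i (dif_neg ?_)
      rintro ⟨x, hx⟩
      exact hcon (f x) ⟨x, rfl⟩ hx.symm
    obtain ⟨i, hi⟩ := this
    exact (PiTensorProduct.tprod ℂ).map_coord_zero i hi
  have key : PiTensorProduct.map (fun i => (b i).constr ℂ (g i))
      (∑ a, PiTensorProduct.tprod ℂ fun i => b i (r i a)) =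
      ∑ x, PiTensorProduct.tprod ℂ fun i => w i x := by
    simp only [map_sum, PiTensorProduct.map_tprod, Module.Basis.constr_basis]
    simp only [← hgf]
    rw [← Finset.sum_image (s := Finset.univ) (g := f)
      (f := fun a => PiTensorProduct.tprod ℂ fun i => g i (r i a)) hf.injOn]
    refine (Finset.sum_subset (Finset.subset_univ _) fun a _ ha => hg0 a ?_).symm
    simpa using ha
  refine ⟨Function.update (fun i => (b i).constr ℂ (g i)) i₀ (c⁻¹ • (b i₀).constr ℂ (g i₀)), ?_⟩
  rw [PiTensorProduct.map_update_smul, Function.update_eq_self, LinearMap.smul_apply, map_smul,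
    key, smul_smul, inv_mul_cancel₀ hc, one_smul]

end Conversion

/-! ### Flattening ranks -/

section Flattening

/-- A sum of products `X α * Y α` where `X` and `Y` share only the coordinates in `F`. -/
theorem card_le_pow_of_sum_eq {I κ B : Type*} [Fintype I] [DecidableEq I] [Fintype κ] [Nonempty κ]
    [Fintype B] [DecidableEq B]
    (F : Finset I) (P Q : Set I) (hPQ : P ∩ Q ⊆ F) (X Y : B → (I → κ) → ℂ)
    (hX : ∀ b, DependsOn (X b) P) (hY : ∀ b, DependsOn (Y b) Q)
    (h : ∀ b b', ∑ α, X b α * Y b' α = if b = b' then 1 else 0) :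
    Fintype.card B ≤ Fintype.card κ ^ F.card := by
  classical
  obtain ⟨z⟩ := ‹Nonempty κ›
  let e₁ := Equiv.piEquivPiSubtypeProd (fun i => i ∈ F) (fun _ : I => κ)
  let e₂ := Equiv.piEquivPiSubtypeProd (fun i : {i // i ∉ F} => i.1 ∈ P) (fun _ => κ)
  -- Each factor is summed over its private coordinates, with `z` as filler where it is constant.
  -- The identity matrix thus factors through dimension |κ|^|F|.
  let X' : Matrix B (({i // i ∈ F}) → κ) ℂ := fun b τ =>
    ∑ p, X b (e₁.symm (τ, e₂.symm (p, fun _ => z)))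
  let Y' : Matrix ({i // i ∈ F} → κ) B ℂ := fun τ b =>
    ∑ q, Y b (e₁.symm (τ, e₂.symm (fun _ => z, q)))
  have h1 : X' * Y' = 1 := by
    ext b b'
    rw [Matrix.one_apply, ← h, ← e₁.symm.sum_comp, Fintype.sum_prod_type, Matrix.mul_apply]
    refine Finset.sum_congr rfl fun τ _ => ?_
    rw [← e₂.symm.sum_comp, Fintype.sum_prod_type, Finset.sum_mul_sum]
    refine Finset.sum_congr rfl fun p _ => Finset.sum_congr rfl fun q _ => ?_
    congr 1
    · refine hX b fun i hi => ?_
      by_cases hF : i ∈ F <;> simp [e₁, e₂, Equiv.piEquivPiSubtypeProd, hF, hi]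
    · refine hY b' fun i hi => ?_
      by_cases hF : i ∈ F
      · simp [e₁, e₂, Equiv.piEquivPiSubtypeProd, hF]
      · have : i ∉ P := fun hP => hF (hPQ ⟨hP, hi⟩)
        simp [e₁, e₂, Equiv.piEquivPiSubtypeProd, hF, this]
  have h2 : (1 : Matrix B B ℂ).rank ≤ Fintype.card ({i // i ∈ F} → κ) := by
    rw [← h1]
    exact (Matrix.rank_mul_le_left _ _).trans (Matrix.rank_le_card_width _)
  simpa [Matrix.rank_one] using h2

/-- The rank of the flattening along a bipartition does not increase under SLOCC. -/
theorem SLOCC.card_le_pow {ι I κ C : Type*} [Fintype ι] [Fintype I] [DecidableEq I] [Fintype κ]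
    [Nonempty κ]
    [Fintype C] {V W : ι → Type*} [∀ i, AddCommGroup (V i)] [∀ i, Module ℂ (V i)]
    [∀ i, AddCommGroup (W i)] [∀ i, Module ℂ (W i)]
    (v : ∀ i, (I → κ) → V i) (D : ι → Set I) (hv : ∀ i, DependsOn (v i) (D i))
    (b : ∀ i, Module.Basis C ℂ (W i)) (P : Set ι) {p q : ι} (hp : p ∈ P) (hq : q ∉ P)
    (F : Finset I) (hF : ∀ i ∈ P, ∀ j ∉ P, D i ∩ D j ⊆ F)
    (h : SLOCC (∑ α, PiTensorProduct.tprod ℂ fun i => v i α)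
      (∑ x, PiTensorProduct.tprod ℂ fun i => b i x)) :
    Fintype.card C ≤ Fintype.card κ ^ F.card := by
  classical
  obtain ⟨A, hA⟩ := h
  refine card_le_pow_of_sum_eq F (⋃ i ∈ P, D i) (⋃ j ∈ Pᶜ, D j) ?_
    (fun x α => ∏ i with i ∈ P, (b i).coord x (A i (v i α)))
    (fun x α => ∏ i with i ∉ P, (b i).coord x (A i (v i α))) ?_ ?_ ?_
  · rintro x ⟨hx, hy⟩
    simp only [Set.mem_iUnion] at hx hy
    obtain ⟨i, hi, hx⟩ := hx
    obtain ⟨j, hj, hy⟩ := hy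
    exact hF i hi j hj ⟨hx, hy⟩
  · intro x α α' hα
    refine Finset.prod_congr rfl fun i hi => ?_
    rw [hv i fun y hy => hα y (Set.mem_biUnion (by simpa using hi) hy)]
  · intro x α α' hα
    refine Finset.prod_congr rfl fun i hi => ?_
    rw [hv i fun y hy => hα y (Set.mem_biUnion (by simpa using hi) hy)]
  · intro x y
    -- `φ` reads off the (x, y) entry of the flattening along `P`; the parties `p` and `q` make both
    -- sides nonempty, so the target gives the identity matrix.
    let φ : (⨂[ℂ] i, W i) →ₗ[ℂ] ℂ := PiTensorProduct.lift
      ((MultilinearMap.mkPiAlgebra ℂ ι ℂ).compLinearMap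
        fun i => if i ∈ P then (b i).coord x else (b i).coord y)
    have hφ : ∀ w : ∀ i, W i, φ (PiTensorProduct.tprod ℂ w) =
        (∏ i with i ∈ P, (b i).coord x (w i)) * ∏ i with i ∉ P, (b i).coord y (w i) := by
      intro w
      simp only [φ, PiTensorProduct.lift.tprod, MultilinearMap.compLinearMap_apply,
        MultilinearMap.mkPiAlgebra_apply]
      rw [← Finset.prod_filter_mul_prod_filter_not Finset.univ (fun i => i ∈ P)]
      congr 1 <;> refine Finset.prod_congr rfl fun i hi => ?_
      · rw [if_pos (by simpa using hi)]
      · rw [if_neg (by simpa using hi)]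
    have h2 := congrArg φ hA
    simp only [map_sum, PiTensorProduct.map_tprod, hφ] at h2
    rw [h2]
    simp only [Module.Basis.coord_apply, Module.Basis.repr_self]
    rw [Finset.sum_eq_single x]
    · rw [Finset.prod_eq_one fun i _ => by simp, one_mul]
      split_ifs with hxy
      · exact Finset.prod_eq_one fun i _ => by simp [hxy]
      · exact Finset.prod_eq_zero (i := q) (by simpa using hq) (by simp [hxy])
    · intro z _ hz
      rw [Finset.prod_eq_zero (i := p) (by simpa using hp) (by simp [hz]), zero_mul]
    · simp

end Flattening

/-! ### Matchings from edge-connectivity -/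

namespace MultiHypergraph

variable {V E : Type*}

/-- Two edges are incident with a common vertex. -/
def Meet (H : MultiHypergraph V E) (e f : E) : Prop := ∃ v, H.Inc v e ∧ H.Inc v f

theorem Meet.symm {H : MultiHypergraph V E} {e f : E} (h : H.Meet e f) : H.Meet f e :=
  h.imp fun _ hv => hv.symm

open Classical in
/-- A form of Menger's theorem, obtained from Hall's theorem: the edges outside `S` can be matched
with edges outside `T` which they meet. -/
theorem IsEdgeConnected.exists_matching [Fintype E] {H : MultiHypergraph V E} {l : ℕ}
    (h : H.IsEdgeConnected l) (hne : ∀ e, ∃ v, H.Inc v e) {x y : V} {S T : Finset E}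
    (hS : ∀ e ∈ S, H.Inc x e) (hT : ∀ e ∈ T, H.Inc y e) (cS : S.card = l) (cT : T.card = l) :
    ∃ σ : {e // e ∉ S} → E, Function.Injective σ ∧ ∀ e, σ e ∉ T ∧ H.Meet e.1 (σ e) := by
  suffices h : ∀ X : Finset {e // e ∉ S}, X.card ≤ (X.biUnion
      fun e => Finset.univ.filter fun f => f ∉ T ∧ H.Meet e.1 f).card by
    obtain ⟨σ, hσ, h⟩ := (Finset.all_card_le_biUnion_card_iff_exists_injective _).1 h
    exact ⟨σ, hσ, fun e => by simpa using h e⟩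
  intro X₀
  by_contra! hcard
  set X : Finset E := X₀.map (Function.Embedding.subtype _) with hX
  set N : Finset E := Finset.univ.filter fun f => ∃ e ∈ X, H.Meet e f with hN
  have hXS : ∀ e ∈ X, e ∉ S := by
    intro e he
    obtain ⟨e', -, rfl⟩ := Finset.mem_map.1 he
    exact e'.2
  have hXN : X ⊆ N := fun e he => by
    obtain ⟨v, hv⟩ := hne e
    exact Finset.mem_filter.2 ⟨Finset.mem_univ _, e, he, v, hv, hv⟩
  have hNT : (N \ T).card < X.card := by
    rw [hX, Finset.card_map]
    refine lt_of_le_of_lt (Finset.card_le_card fun f hf => ?_) hcard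
    obtain ⟨h1, h2⟩ := Finset.mem_sdiff.1 hf
    obtain ⟨e, he, hef⟩ := (Finset.mem_filter.1 h1).2
    obtain ⟨e', he', rfl⟩ := Finset.mem_map.1 he
    exact Finset.mem_biUnion.2 ⟨e', he', Finset.mem_filter.2 ⟨Finset.mem_univ _, h2, hef⟩⟩
  have e1 := Finset.card_sdiff_add_card_inter N T
  have e2 := Finset.card_sdiff_add_card_eq_card hXN
  -- Fewer than `l` edges lie in `N \ X`. After deleting them, a walk from `y` stays among vertices
  -- touched by `X`, since any surviving edge it meets is in `X`. It reaches `x`, which forces `S ⊆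
  -- N \ X`, too large a set.
  have hC : (N \ X).card < (N ∩ T).card := by omega
  have hCl : (N \ X).card < l :=
    hC.trans_le (cT ▸ Finset.card_le_card Finset.inter_subset_right)
  obtain ⟨t, htT, htX⟩ : ∃ t ∈ T, t ∈ X := by
    by_contra! hcon
    refine hC.not_ge (Finset.card_le_card fun t ht => ?_)
    obtain ⟨h1, h2⟩ := Finset.mem_inter.1 ht
    exact Finset.mem_sdiff.2 ⟨h1, hcon t h2⟩
  obtain ⟨s, hsS, hsC⟩ : ∃ s ∈ S, s ∉ N \ X := Finset.exists_mem_notMem_of_card_lt_card (by omega)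
  have hreach := h (↑(N \ X)) (by rw [Set.encard_coe_eq_coe_finsetCard]; exact_mod_cast hCl) y x
  have hX' : ∃ e ∈ X, H.Inc x e := by
    clear hS
    induction hreach with
    | refl => exact ⟨t, htX, hT t htT⟩
    | tail _ hstep ih =>
      obtain ⟨e₀, he₀, hi₀⟩ := ih
      obtain ⟨⟨e, heC⟩, hu, hv⟩ := hstep
      refine ⟨e, ?_, hv⟩
      by_contra heX
      exact heC (Finset.mem_sdiff.2
        ⟨Finset.mem_filter.2 ⟨Finset.mem_univ _, e₀, he₀, _, hi₀, hu⟩, heX⟩)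
  obtain ⟨e, heX, he⟩ := hX'
  exact hsC (Finset.mem_sdiff.2 ⟨Finset.mem_filter.2 ⟨Finset.mem_univ _, e, heX, x, he, hS s hsS⟩,
    fun hs => hXS s hs hsS⟩)

end MultiHypergraph

/-! ### Link matrices: positivity and separation -/

section LinkMatrix

variable {E : Type*} [Fintype E] [DecidableEq E]

/-- The matrix with `3` on the diagonal to which each link `e ↦ σ e` contributes a pair of
symmetric entries `1`. -/
def linkMatrix {S : Finset E} (σ : {e // e ∉ S} → E) : Matrix E E ℤ :=
  (3 : ℤ) • 1 + ∑ u, (Matrix.single u.1 (σ u) 1 + Matrix.single (σ u) u.1 1)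

theorem linkMatrix_isSymm {S : Finset E} (σ : {e // e ∉ S} → E) : (linkMatrix σ).IsSymm := by
  unfold Matrix.IsSymm linkMatrix
  simp only [Matrix.transpose_add, Matrix.transpose_smul, Matrix.transpose_one,
    Matrix.transpose_sum, Matrix.transpose_single]
  congr 1
  exact Finset.sum_congr rfl fun u _ => add_comm _ _

theorem linkMatrix_apply {S : Finset E} (σ : {e // e ∉ S} → E) (e f : E) :
    linkMatrix σ e f = 3 * (if e = f then 1 else 0) +
      ∑ u : {e // e ∉ S}, ((if u.1 = e ∧ σ u = f then 1 else 0) +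
        (if σ u = e ∧ u.1 = f then 1 else 0)) := by
  simp only [linkMatrix, Matrix.add_apply, Matrix.smul_apply, Matrix.sum_apply,
    Matrix.single_apply, Matrix.one_apply, smul_eq_mul]

theorem exists_link_of_linkMatrix_ne_zero {S : Finset E} {σ : {e // e ∉ S} → E} {e f : E}
    (h : linkMatrix σ e f ≠ 0) : e = f ∨ ∃ u, (u.1 = e ∧ σ u = f) ∨ (σ u = e ∧ u.1 = f) := by
  contrapose! h
  rw [linkMatrix_apply, if_neg h.1, Finset.sum_eq_zero, mul_zero, add_zero]
  intro u _
  rw [if_neg (by have := h.2 u; tauto), if_neg (by have := h.2 u; tauto), add_zero]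

theorem linkMatrix_mulVec {S : Finset E} (σ : {e // e ∉ S} → E) (x : E → ℤ) (e : E) :
    (linkMatrix σ).mulVec x e = 3 * x e +
      ∑ u : {e // e ∉ S}, ((if u.1 = e then x (σ u) else 0) + (if σ u = e then x u else 0)) := by
  simp only [linkMatrix, Matrix.add_mulVec, Matrix.smul_mulVec, Matrix.one_mulVec,
    Matrix.sum_mulVec, Pi.add_apply, Pi.smul_apply, Finset.sum_apply, smul_eq_mul]
  congr 1
  refine Finset.sum_congr rfl fun u _ => ?_
  simp [Matrix.single_mulVec, Function.update_apply, eq_comm]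

/-- A link lowers the form by at most x_u² + x_{σ u}². As `σ` is injective, these total at most
2‖x‖², against 3‖x‖² from the diagonal. -/
theorem linkMatrix_posDef {S : Finset E} {σ : {e // e ∉ S} → E} (hσ : Function.Injective σ)
    {x : E → ℝ} (hx : x ≠ 0) : 0 < x ⬝ᵥ ((linkMatrix σ).map (Int.cast : ℤ → ℝ)).mulVec x := by
  have h1 : x ⬝ᵥ ((linkMatrix σ).map (Int.cast : ℤ → ℝ)).mulVec x =
      3 * ∑ e, x e ^ 2 + ∑ u : {e // e ∉ S}, 2 * (x u * x (σ u)) := by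
    have hM : (linkMatrix σ).map (Int.cast : ℤ → ℝ) = (3 : ℝ) • 1 +
        ∑ u : {e // e ∉ S}, (Matrix.single u.1 (σ u) 1 + Matrix.single (σ u) u.1 1) := by
      ext e f
      simp only [Matrix.map_apply, linkMatrix_apply, Matrix.add_apply, Matrix.smul_apply,
        Matrix.sum_apply, Matrix.single_apply, Matrix.one_apply, smul_eq_mul]
      push_cast
      rfl
    simp only [hM, Matrix.add_mulVec, Matrix.smul_mulVec, Matrix.one_mulVec, Matrix.sum_mulVec,
      dotProduct_add, dotProduct_smul, dotProduct_sum, Matrix.single_mulVec, smul_eq_mul]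
    congr 1
    · simp [dotProduct, sq]
    · refine Finset.sum_congr rfl fun u _ => ?_
      simp [dotProduct, Function.update_apply]
      ring
  have h2 : ∑ u : {e // e ∉ S}, x u ^ 2 ≤ ∑ e, x e ^ 2 := by
    rw [← Finset.sum_image (f := fun e => x e ^ 2) (g := Subtype.val) (s := Finset.univ)
      Subtype.val_injective.injOn]
    exact Finset.sum_le_univ_sum_of_nonneg fun _ => sq_nonneg _
  have h3 : ∑ u : {e // e ∉ S}, x (σ u) ^ 2 ≤ ∑ e, x e ^ 2 := by
    rw [← Finset.sum_image (f := fun e => x e ^ 2) (g := σ) (s := Finset.univ) hσ.injOn]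
    exact Finset.sum_le_univ_sum_of_nonneg fun _ => sq_nonneg _
  have h4 : 0 ≤ ∑ u : {e // e ∉ S}, (2 * (x u * x (σ u)) + x u ^ 2 + x (σ u) ^ 2) :=
    Finset.sum_nonneg fun u _ => by nlinarith [sq_nonneg (x u + x (σ u))]
  have h5 : 0 < ∑ e, x e ^ 2 := by
    obtain ⟨e, he⟩ := Function.ne_iff.1 hx
    exact Finset.sum_pos' (fun _ _ => sq_nonneg _) ⟨e, Finset.mem_univ _, by
      have : x e ≠ 0 := he
      positivity⟩
  rw [Finset.sum_add_distrib, Finset.sum_add_distrib] at h4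
  rw [h1]
  linarith

/-- Vectors vanishing on `T` are determined by the entries outside `S` of their image under `M`. -/
def SeparatesOff (M : Matrix E E ℤ) (S T : Finset E) : Prop :=
  ∀ x : E → ℤ, (∀ e ∈ T, x e = 0) → (∀ e ∉ S, M.mulVec x e = 0) → x = 0

/-- The links arrange the edges into paths from `T` to `S` and cycles. Along a path the row
equations propagate zeros from `T`; on the cycles the diagonal entry 3 dominates the two neighbours.
-/
theorem linkMatrix_separatesOff {S T : Finset E} {σ : {e // e ∉ S} → E}
    (hσ : Function.Injective σ) (hT : ∀ u, σ u ∉ T) (hcard : S.card = T.card) :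
    SeparatesOff (linkMatrix σ) S T := by
  intro x hxT hxS
  have hsurj : ∀ e ∉ T, ∃ u, σ u = e := by
    have h : Finset.univ.image σ = Tᶜ := by
      refine Finset.eq_of_subset_of_card_le (fun e he => ?_) ?_
      · obtain ⟨u, -, rfl⟩ := Finset.mem_image.1 he
        exact Finset.mem_compl.2 (hT u)
      · rw [Finset.card_image_of_injective _ hσ, Finset.card_univ, Fintype.card_subtype_compl,
          Finset.card_compl, Fintype.card_coe, hcard]
    intro e he
    simpa using (h ▸ Finset.mem_compl.2 he : e ∈ Finset.univ.image σ)
  have hrow : ∀ u : {e // e ∉ S}, 3 * x u + x (σ u) +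
      ∑ w : {e // e ∉ S}, (if σ w = u then x w else 0) = 0 := by
    intro u
    have h := hxS u u.2
    rw [linkMatrix_mulVec, Finset.sum_add_distrib] at h
    simp only [Subtype.coe_inj, Finset.sum_ite_eq', Finset.mem_univ, if_true] at h
    linarith
  -- Two consecutive zeros are what the three-term recursion needs to continue.
  set Z : Set E := {e | x e = 0 ∧ ∀ u, σ u = e → x u = 0} with hZ
  have hTZ : ∀ e ∈ T, e ∈ Z := fun e he => ⟨hxT e he, fun u hu => absurd he (hu ▸ hT u)⟩
  have hstep : ∀ u : {e // e ∉ S}, u.1 ∈ Z → σ u ∈ Z := by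
    rintro u ⟨h1, h2⟩
    refine ⟨?_, fun w hw => hσ hw ▸ h1⟩
    have h := hrow u
    rw [Finset.sum_eq_zero, h1] at h
    · linarith
    · intro w _
      split_ifs with hw
      exacts [h2 w hw, rfl]
  have hback : ∀ e : {e // e ∉ Z}, ∃ u : {e // e ∉ S}, σ u = e ∧ u.1 ∉ Z := by
    intro e
    obtain ⟨u, hu⟩ := hsurj e fun h => e.2 (hTZ e h)
    exact ⟨u, hu, fun h => e.2 (hu ▸ hstep u h)⟩
  choose p hp hpZ using hback
  -- Taking predecessors permutes the finite complement of `Z`, so all edges there are sources of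
  -- links and lie outside `S`.
  have hpinj : Function.Injective fun e => (⟨(p e).1, hpZ e⟩ : {e // e ∉ Z}) := by
    intro e f h
    have h' : p e = p f := Subtype.ext (Subtype.mk.inj h)
    exact Subtype.ext (by rw [← hp e, ← hp f, h'])
  have hZS : ∀ e ∉ Z, e ∉ S := by
    intro e he
    obtain ⟨f, hf⟩ := Finite.surjective_of_injective hpinj ⟨e, he⟩
    exact (Subtype.mk.inj hf) ▸ (p f).2
  by_contra hx
  obtain ⟨e₀, he₀⟩ := Function.ne_iff.1 hx
  obtain ⟨e, -, he⟩ := Finset.exists_max_image Finset.univ (fun e => |x e|) ⟨e₀, Finset.mem_univ _⟩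
  have hpos : 0 < |x e| := (abs_pos.2 he₀).trans_le (he e₀ (Finset.mem_univ _))
  have heZ : e ∉ Z := fun h => hpos.ne' (by rw [h.1, abs_zero])
  have h := hrow ⟨e, hZS e heZ⟩
  obtain ⟨u, hu⟩ := hsurj e fun h => heZ (hTZ e h)
  rw [Finset.sum_eq_single u (fun w _ hw => if_neg fun h => hw (hσ (h.trans hu.symm)))
    (fun h => absurd (Finset.mem_univ _) h), if_pos hu] at h
  have h1 := he (σ ⟨e, hZS e heZ⟩) (Finset.mem_univ _)
  have h2 := he u (Finset.mem_univ _)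
  have h3 := abs_le.1 h1
  have h4 := abs_le.1 h2
  rcases abs_cases (x e) with h5 | h5 <;> linarith

/-- Makes separation the nonvanishing of a polynomial in the entries of `M`. Here `σ` only
enumerates the complement of `T`, so that the minor is square. -/
theorem separatesOff_iff_det_ne_zero {S T : Finset E} {σ : {e // e ∉ S} → E}
    (hσ : Function.Injective σ) (hT : ∀ u, σ u ∉ T) (hcard : S.card = T.card) (M : Matrix E E ℤ) :
    SeparatesOff M S T ↔ (M.submatrix (Subtype.val : {e // e ∉ S} → E) σ).det ≠ 0 := by
  have himage : Finset.univ.image σ = Tᶜ := by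
    refine Finset.eq_of_subset_of_card_le (fun e he => ?_) ?_
    · obtain ⟨u, -, rfl⟩ := Finset.mem_image.1 he
      exact Finset.mem_compl.2 (hT u)
    · rw [Finset.card_image_of_injective _ hσ, Finset.card_univ, Fintype.card_subtype_compl,
        Finset.card_compl, Fintype.card_coe, hcard]
  have hmul : ∀ x : E → ℤ, (∀ e ∈ T, x e = 0) → ∀ u : {e // e ∉ S},
      (M.submatrix (Subtype.val : {e // e ∉ S} → E) σ).mulVec (x ∘ σ) u = M.mulVec x u := by
    intro x hx u
    simp only [Matrix.mulVec, dotProduct, Matrix.submatrix_apply, Function.comp_apply]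
    rw [← Finset.sum_image (f := fun e => M u e * x e) (g := σ) (s := Finset.univ) hσ.injOn, himage]
    refine Finset.sum_subset (Finset.subset_univ _) fun e _ he => ?_
    rw [hx e (by simpa using he), mul_zero]
  rw [Ne, ← Matrix.exists_mulVec_eq_zero_iff]
  push Not
  constructor
  · intro h y hy hMy
    set x : E → ℤ := Function.extend σ y 0 with hx
    have hxT : ∀ e ∈ T, x e = 0 := fun e he =>
      Function.extend_apply' _ _ _ fun ⟨u, hu⟩ => hT u (hu ▸ he)
    have hxσ : x ∘ σ = y := funext fun u => hσ.extend_apply _ _ u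
    refine hy ?_
    rw [← hxσ, h x hxT fun e he => ?_]
    · rfl
    · rw [← hmul x hxT ⟨e, he⟩, hxσ, hMy, Pi.zero_apply]
  · intro h x hxT hxS
    by_contra hx
    refine h (x ∘ σ) (fun h0 => hx ?_) (funext fun u => by rw [hmul x hxT u, hxS u u.2]; rfl)
    funext e
    by_cases he : e ∈ T
    · exact hxT e he
    · obtain ⟨u, -, rfl⟩ := Finset.mem_image.1 (himage ▸ Finset.mem_compl.2 he)
      exact congrFun h0 u

end LinkMatrix

/-! ### Separation at all vertices simultaneously -/

section Generic

variable {E V : Type*} [Fintype E] [DecidableEq E] [Fintype V]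

open Classical in
/-- A generic positive combination of matrices separates wherever one of them does. -/
theorem exists_pos_separatesOff {S : Finset E} {T : V → Finset E} {σ : V → {e // e ∉ S} → E}
    (hσ : ∀ v, Function.Injective (σ v)) (hT : ∀ v u, σ v u ∉ T v)
    (hcard : ∀ v, S.card = (T v).card) (M : V → Matrix E E ℤ)
    (hM : ∀ v, SeparatesOff (M v) S (T v)) :
    ∃ c : V → ℤ, (∀ v, 0 < c v) ∧ ∀ v, SeparatesOff (∑ w, c w • M w) S (T v) := by
  let P : V → MvPolynomial V ℤ := fun v => Matrix.det
    ((∑ w, (MvPolynomial.X w : MvPolynomial V ℤ) • (M w).map (MvPolynomial.C : ℤ →+* _) :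
      Matrix E E (MvPolynomial V ℤ)).submatrix
      (Subtype.val : {e // e ∉ S} → E) (σ v))
  have heval : ∀ (c : V → ℤ) v, MvPolynomial.eval c (P v) =
      ((∑ w, c w • M w).submatrix (Subtype.val : {e // e ∉ S} → E) (σ v)).det := by
    intro c v
    rw [RingHom.map_det]
    congr 1
    ext a b
    simp only [RingHom.mapMatrix_apply, Matrix.map_apply, Matrix.submatrix_apply, Matrix.sum_apply,
      Matrix.smul_apply, smul_eq_mul, map_sum, map_mul, MvPolynomial.eval_X, MvPolynomial.eval_C]
  have hP : ∏ v, P v ≠ 0 := by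
    refine Finset.prod_ne_zero_iff.2 fun v _ h0 => ?_
    refine (separatesOff_iff_det_ne_zero (hσ v) (hT v) (hcard v) _).1 (hM v) ?_
    -- At this point the combination is `M v` itself, whose minor is nonzero.
    have h := heval (Pi.single v 1) v
    rw [h0, map_zero] at h
    rw [h]
    simp [Pi.single_apply, ite_smul]
  by_contra! hcon
  refine hP (MvPolynomial.funext_set (fun _ => Set.Ioi (0 : ℤ)) (fun _ => Set.Ioi_infinite 0)
    fun c hc => ?_)
  obtain ⟨v, hv⟩ := hcon c fun v => hc v trivial
  rw [map_zero, map_prod]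
  refine Finset.prod_eq_zero (Finset.mem_univ v) ?_
  rw [heval]
  by_contra hne
  exact hv ((separatesOff_iff_det_ne_zero (hσ v) (hT v) (hcard v) _).2 hne)

end Generic

/-! ### Local quadratic forms -/

namespace MultiHypergraph

variable {V E : Type*} [Fintype V] [Fintype E]

open Classical in
/-- A quadratic form whose coefficients couple only meeting edges is a sum of local functions. -/
theorem exists_local_decomposition (H : MultiHypergraph V E) (R : Matrix E E ℝ)
    (hR : ∀ e f, R e f ≠ 0 → H.Meet e f) :
    ∃ u : V → (E → ℤ) → ℝ, (∀ v, DependsOn (u v) {e | H.Inc v e}) ∧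
      ∀ x : E → ℤ, ∑ v, u v x =
        (fun e => (x e : ℝ)) ⬝ᵥ R.mulVec (fun e => (x e : ℝ)) := by
  refine ⟨fun v x => ∑ e, ∑ f, if ∃ h : H.Meet e f, h.choose = v then x e * (R e f * x f) else 0,
    fun v x y hxy => ?_, fun x => ?_⟩
  · refine Finset.sum_congr rfl fun e _ => Finset.sum_congr rfl fun f _ => ?_
    split_ifs with h
    · obtain ⟨h, rfl⟩ := h
      rw [hxy e h.choose_spec.1, hxy f h.choose_spec.2]
    · rfl
  · simp only [dotProduct, Matrix.mulVec, Finset.mul_sum]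
    rw [Finset.sum_comm]
    refine Finset.sum_congr rfl fun e _ => ?_
    rw [Finset.sum_comm]
    refine Finset.sum_congr rfl fun f _ => ?_
    by_cases h : H.Meet e f
    · simp [h]
    · have h0 : R e f = 0 := by
        by_contra h0
        exact h (hR e f h0)
      simp [h0]

/-- The squared deviation from the linear equations of `M` outside `S`, measured by the inverse of
a principal submatrix, is a sum of local functions. -/
theorem exists_tight [DecidableEq E] (H : MultiHypergraph V E) (M : Matrix E E ℤ)
    (hlocal : ∀ e f, M e f ≠ 0 → H.Meet e f)
    (hpos : (M.map (Int.cast : ℤ → ℝ)).PosDef) {S : Finset E} {v₀ : V}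
    (hS : ∀ e ∈ S, H.Inc v₀ e) :
    ∃ u : V → (E → ℤ) → ℝ, (∀ v, DependsOn (u v) {e | H.Inc v e}) ∧ (∀ x, 0 ≤ ∑ v, u v x) ∧
      ∀ x, ∑ v, u v x = 0 ↔ ∀ e ∉ S, M.mulVec x e = 0 := by
  set K : Matrix {e // e ∉ S} E ℝ := (M.map (Int.cast : ℤ → ℝ)).submatrix Subtype.val id with hK
  set N : Matrix {e // e ∉ S} {e // e ∉ S} ℝ :=
    (M.map (Int.cast : ℤ → ℝ)).submatrix Subtype.val Subtype.val with hN
  have hNpos : N.PosDef := hpos.submatrix Subtype.val_injective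
  have hNinv : N⁻¹.PosDef := hNpos.inv
  have hNsymm : N⁻¹.transpose = N⁻¹ := by
    have := hNinv.1
    rwa [Matrix.IsHermitian, Matrix.conjTranspose_eq_transpose_of_trivial] at this
  -- Since N⁻¹N = 1, `R` agrees with `M` away from S × S. Its entries on S × S are uncontrolled, but
  -- harmless: all edges of `S` meet at `v₀`.
  set R : Matrix E E ℝ := K.transpose * (N⁻¹ * K) with hR
  have hcol : ∀ e (w : {e // e ∉ S}), R e w = M w e := by
    intro e w
    have h1 : ∀ a, (N⁻¹ * K) a w = (1 : Matrix {e // e ∉ S} {e // e ∉ S} ℝ) a w := by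
      intro a
      rw [← Matrix.nonsing_inv_mul N ((Matrix.isUnit_iff_isUnit_det _).1 hNpos.isUnit)]
      rfl
    rw [hR, Matrix.mul_apply]
    simp only [h1, Matrix.one_apply, mul_ite, mul_one, mul_zero, Finset.sum_ite_eq',
      Finset.mem_univ, if_true]
    rfl
  have hRsymm : ∀ e f, R e f = R f e := by
    have : R.transpose = R := by
      rw [hR, Matrix.transpose_mul, Matrix.transpose_mul, Matrix.transpose_transpose, hNsymm,
        Matrix.mul_assoc]
    intro e f
    exact (congrFun (congrFun this f) e)
  have hRlocal : ∀ e f, R e f ≠ 0 → H.Meet e f := by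
    intro e f hef
    by_cases hf : f ∈ S
    · by_cases he : e ∈ S
      · exact ⟨v₀, hS e he, hS f hf⟩
      · rw [hRsymm, hcol f ⟨e, he⟩] at hef
        exact hlocal e f (by exact_mod_cast hef)
    · rw [hcol e ⟨f, hf⟩] at hef
      exact (hlocal f e (by exact_mod_cast hef)).symm
  obtain ⟨u, hu, hsum⟩ := H.exists_local_decomposition R hRlocal
  have hquad : ∀ x : E → ℝ, x ⬝ᵥ R.mulVec x = K.mulVec x ⬝ᵥ N⁻¹.mulVec (K.mulVec x) := by
    intro x
    rw [hR, ← Matrix.mulVec_mulVec, ← Matrix.mulVec_mulVec, Matrix.dotProduct_mulVec,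
      Matrix.vecMul_transpose]
  have hKx : ∀ (x : E → ℤ) (w : {e // e ∉ S}),
      K.mulVec (fun e => (x e : ℝ)) w = (M.mulVec x w : ℤ) := by
    intro x w
    simp [hK, Matrix.mulVec, dotProduct]
  refine ⟨u, hu, fun x => ?_, fun x => ?_⟩
  · rw [hsum, hquad]
    simpa using hNinv.posSemidef.dotProduct_mulVec_nonneg (K.mulVec fun e => (x e : ℝ))
  · rw [hsum, hquad]
    constructor
    · intro h e he
      have h0 : K.mulVec (fun e => (x e : ℝ)) = 0 := by
        by_contra hne
        have := hNinv.dotProduct_mulVec_pos hne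
        rw [star_trivial] at this
        exact this.ne' h
      have h1 := hKx x ⟨e, he⟩
      rw [h0, Pi.zero_apply] at h1
      exact_mod_cast h1.symm
    · intro h
      have h0 : K.mulVec (fun e => (x e : ℝ)) = 0 := by
        funext w
        rw [hKx, h w w.2]
        simp
      rw [h0, zero_dotProduct]

end MultiHypergraph

/-! ### Integer solutions and their size -/

/-- Cramer's rule: integer solutions of the linear equations of `M` outside `S`, parametrized by
their entries in `S`. -/
theorem exists_integer_solutions {E : Type*} [Fintype E] [DecidableEq E] (M : Matrix E E ℤ)
    (hpos : (M.map (Int.cast : ℤ → ℝ)).PosDef) (S : Finset E) :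
    ∃ (B : Matrix E {e // e ∈ S} ℤ), (∀ s, ∀ e ∉ S, M.mulVec (B.mulVec s) e = 0) ∧
      Function.Injective B.mulVec := by
  set K : Matrix {e // e ∉ S} E ℤ := M.submatrix Subtype.val id with hK
  set N : Matrix {e // e ∉ S} {e // e ∉ S} ℤ := M.submatrix Subtype.val Subtype.val with hN
  have hdet : N.det ≠ 0 := by
    intro h0
    have h1 := (hpos.submatrix (Subtype.val_injective (p := fun e => e ∉ S))).det_pos
    have h2 : (N.map (Int.cast : ℤ → ℝ)).det = ((N.det : ℤ) : ℝ) :=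
      ((Int.castRingHom ℝ).map_det N).symm
    rw [h0, Int.cast_zero] at h2
    exact h1.ne' h2
  set Y : Matrix E {e // e ∈ S} ℤ := (1 : Matrix E E ℤ).submatrix id Subtype.val with hY
  set Z : Matrix E {e // e ∉ S} ℤ := (1 : Matrix E E ℤ).submatrix id Subtype.val with hZ
  have hKZ : K * Z = N := by
    ext a b
    simp [hK, hZ, hN, Matrix.mul_apply, Matrix.one_apply]
  -- Scaling by `N.det` keeps the solution integral; its entries in `S` are `N.det * s`, whence
  -- injectivity.
  refine ⟨N.det • Y - Z * (N.adjugate * (K * Y)), fun s e he => ?_, fun s t hst => ?_⟩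
  · have h : K * (N.det • Y - Z * (N.adjugate * (K * Y))) = 0 := by
      rw [Matrix.mul_sub, ← Matrix.mul_assoc K Z, hKZ, ← Matrix.mul_assoc N, Matrix.mul_adjugate,
        Matrix.mul_smul, Matrix.smul_mul, Matrix.one_mul, sub_self]
    have h2 := congrFun (congrArg (fun A => Matrix.mulVec A s) h) ⟨e, he⟩
    simp only [← Matrix.mulVec_mulVec, Matrix.zero_mulVec] at h2
    exact h2
  · have hrow : ∀ (s : {e // e ∈ S} → ℤ) (e : {e // e ∈ S}),
        (N.det • Y - Z * (N.adjugate * (K * Y))).mulVec s e = N.det * s e := by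
      intro s e
      rw [Matrix.sub_mulVec, Pi.sub_apply, ← Matrix.mulVec_mulVec, Matrix.smul_mulVec,
        Pi.smul_apply, smul_eq_mul]
      have h1 : Y.mulVec s e = s e := by
        simp [hY, Matrix.mulVec, dotProduct, Matrix.one_apply]
      have h2 : ∀ t, Z.mulVec t e = 0 := by
        intro t
        refine Finset.sum_eq_zero fun w _ => ?_
        have : e.1 ≠ w.1 := fun h => w.2 (h ▸ e.2)
        simp [hZ, this]
      rw [h1, h2, sub_zero]
    funext e
    have h := congrFun hst e.1
    rw [hrow, hrow] at h
    exact mul_left_cancel₀ hdet h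

theorem Matrix.exists_abs_mulVec_le {m n : Type*} [Fintype m] [Fintype n] (B : Matrix m n ℤ) :
    ∃ C : ℕ, ∀ (q : ℕ) (s : n → ℤ), (∀ i, |s i| ≤ q) → ∀ j, |B.mulVec s j| ≤ C * q := by
  refine ⟨(∑ j, ∑ i, |B j i|).toNat, fun q s hs j => ?_⟩
  rw [Int.toNat_of_nonneg (by positivity)]
  calc |B.mulVec s j| ≤ ∑ i, |B j i * s i| := Finset.abs_sum_le_sum_abs _ _
    _ ≤ ∑ i, |B j i| * q := Finset.sum_le_sum fun i _ => by
        rw [abs_mul]; exact mul_le_mul_of_nonneg_left (hs i) (abs_nonneg _)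
    _ = (∑ i, |B j i|) * q := by rw [Finset.sum_mul]
    _ ≤ _ := mul_le_mul_of_nonneg_right
        (Finset.single_le_sum (f := fun j => ∑ i, |B j i|) (fun _ _ => by positivity)
          (Finset.mem_univ j)) (by positivity)

/-! ### The method of types -/

open Classical in
/-- The method of types: if `Z` is cut out by a sum of local functions attaining its minimum, and
every party can distinguish the elements of `Z`, then the `N`-th powers contain a diagonal set
whose size is that of `Z ^ N` up to a polynomial factor. -/
theorem exists_isDiagonalSet_of_tight {J X : Type*} [Fintype J] [Nonempty J] {Y : J → Type*}
    [∀ j, Fintype (Y j)] (r : ∀ j, X → Y j) (u : ∀ j, Y j → ℝ) (Z : Finset X)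
    (h0 : ∀ x, 0 ≤ ∑ j, u j (r j x)) (hZ : ∀ x, ∑ j, u j (r j x) = 0 ↔ x ∈ Z)
    (hinj : ∀ j, Set.InjOn (r j) Z) (N : ℕ) :
    ∃ S : Finset (Fin N → X),
      IsDiagonalSet (fun j (α : Fin N → X) (l : Fin N) => r j (α l)) (S : Set (Fin N → X)) ∧
      Z.card ^ N ≤ (N + 1) ^ (∑ j, Fintype.card (Y j)) * S.card := by
  -- The type of a party's word: how often each local symbol occurs.
  let cnt : (Fin N → X) → ∀ j, Y j → Fin (N + 1) := fun α j y =>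
    ⟨(Finset.univ.filter fun l => r j (α l) = y).card,
      Nat.lt_succ_of_le ((Finset.card_filter_le _ _).trans (by simp))⟩
  have hcnt : ∀ (α β : Fin N → X) j, cnt α j = cnt β j →
      ∑ l, u j (r j (α l)) = ∑ l, u j (r j (β l)) := by
    have h : ∀ (α : Fin N → X) j, ∑ l, u j (r j (α l)) = ∑ y, (cnt α j y : ℕ) * u j y := by
      intro α j
      rw [← Finset.sum_fiberwise Finset.univ (fun l => r j (α l))]
      refine Finset.sum_congr rfl fun y _ => ?_
      rw [Finset.sum_congr rfl (g := fun _ => u j y)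
        (fun l hl => by rw [(Finset.mem_filter.1 hl).2]), Finset.sum_const, nsmul_eq_mul]
    intro α β j hαβ
    rw [h, h, hαβ]
  let ZN : Finset (Fin N → X) := Fintype.piFinset fun _ => Z
  obtain ⟨τ, hτ⟩ : ∃ τ, ZN.card ≤
      (N + 1) ^ (∑ j, Fintype.card (Y j)) * (ZN.filter fun α => cnt α = τ).card := by
    by_contra! hcon
    have h1 := Finset.card_eq_sum_card_fiberwise (f := cnt) (s := ZN) (t := Finset.univ)
      (fun _ _ => Finset.mem_coe.2 (Finset.mem_univ _))
    have h2 : (N + 1) ^ (∑ j, Fintype.card (Y j)) = Fintype.card (∀ j, Y j → Fin (N + 1)) := by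
      simp [Finset.prod_pow_eq_pow_sum]
    have h3 := Finset.sum_lt_sum_of_nonempty (s := (Finset.univ : Finset (∀ j, Y j → Fin (N + 1))))
      ⟨fun _ _ => 0, Finset.mem_univ _⟩ (fun τ _ => hcon τ)
    rw [← Finset.mul_sum, ← h1, Finset.sum_const, Finset.card_univ, ← h2, smul_eq_mul] at h3
    exact lt_irrefl _ h3
  refine ⟨ZN.filter fun α => cnt α = τ, ⟨fun j α hα β hβ h => ?_, fun α hα => ?_⟩, ?_⟩
  · have hα := Fintype.mem_piFinset.1 (Finset.mem_filter.1 (Finset.mem_coe.1 hα)).1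
    have hβ := Fintype.mem_piFinset.1 (Finset.mem_filter.1 (Finset.mem_coe.1 hβ)).1
    exact funext fun l => hinj j (hα l) (hβ l) (congrFun h l)
  · choose s hs hsα using hα
    simp only [Finset.coe_filter, Set.mem_ofPred_eq] at hs ⊢
    have hτα : ∀ j, cnt α j = τ j := by
      intro j
      rw [← (hs j).2]
      funext y
      refine Fin.ext ?_
      have h : ∀ l, r j (α l) = r j (s j l) := fun l => congrFun (hsα j) l
      simp only [cnt, h]
    refine ⟨?_, funext hτα⟩
    set t := s (Classical.arbitrary J) with ht
    have htS := hs (Classical.arbitrary J)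
    rw [← ht] at htS
    -- Local sums depend only on types, so `α` has the same total as `t`, namely 0; the nonnegative
    -- contributions of the positions then vanish one by one.
    have hsum : ∑ l, ∑ j, u j (r j (α l)) = 0 := by
      rw [Finset.sum_comm, Finset.sum_congr rfl (g := fun j => ∑ l, u j (r j (t l)))
        (fun j _ => hcnt α t j (by rw [hτα, htS.2])), Finset.sum_comm]
      exact Finset.sum_eq_zero fun l _ => (hZ _).2 (Fintype.mem_piFinset.1 htS.1 l)
    rw [Finset.sum_eq_zero_iff_of_nonneg fun l _ => h0 _] at hsum
    exact Fintype.mem_piFinset.2 fun l => (hZ _).1 (hsum l (Finset.mem_univ l))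
  · simpa [ZN] using hτ

/-! ### Large diagonal sets from edge-connectivity -/

namespace MultiHypergraph

variable {V E : Type*} [Fintype V] [Fintype E]

/-- A system of linear equations with a local positive definite matrix whose solutions are
determined by the entries at any `l` edges incident with a common vertex. -/
theorem IsEdgeConnected.exists_matrix [DecidableEq E] [Nonempty V] {H : MultiHypergraph V E}
    {l : ℕ} (hl : H.IsEdgeConnected l) (hne : ∀ e, ∃ v, H.Inc v e) {v₀ : V} {S : Finset E}
    (hS : ∀ e ∈ S, H.Inc v₀ e) (cS : S.card = l) {T : V → Finset E}
    (hT : ∀ v, ∀ e ∈ T v, H.Inc v e) (cT : ∀ v, (T v).card = l) :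
    ∃ M : Matrix E E ℤ, (∀ e f, M e f ≠ 0 → H.Meet e f) ∧
      (M.map (Int.cast : ℤ → ℝ)).PosDef ∧ ∀ v, SeparatesOff M S (T v) := by
  classical
  have hσ := fun v => hl.exists_matching hne hS (hT v) cS (cT v)
  choose σ hinj hσ using hσ
  obtain ⟨c, hc, hsep⟩ := exists_pos_separatesOff hinj (fun v u => (hσ v u).1)
    (fun v => cS.trans (cT v).symm) (fun v => linkMatrix (σ v))
    (fun v => linkMatrix_separatesOff (hinj v) (fun u => (hσ v u).1) (cS.trans (cT v).symm))
  refine ⟨_, fun e f hef => ?_, ?_, hsep⟩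
  · rw [Matrix.sum_apply] at hef
    obtain ⟨v, -, hv⟩ := Finset.exists_ne_zero_of_sum_ne_zero hef
    obtain rfl | ⟨u, ⟨rfl, rfl⟩ | ⟨rfl, rfl⟩⟩ :=
      exists_link_of_linkMatrix_ne_zero (right_ne_zero_of_mul hv)
    · obtain ⟨w, hw⟩ := hne e
      exact ⟨w, hw, hw⟩
    · exact (hσ v u).2
    · exact (hσ v u).2.symm
  · have hmap : (∑ v, c v • linkMatrix (σ v)).map (Int.cast : ℤ → ℝ) =
        ∑ v, (c v : ℝ) • (linkMatrix (σ v)).map (Int.cast : ℤ → ℝ) := by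
      ext e f
      simp only [Matrix.map_apply, Matrix.sum_apply, Matrix.smul_apply, smul_eq_mul]
      push_cast
      rfl
    refine Matrix.PosDef.of_dotProduct_mulVec_pos ?_ fun x hx => ?_
    · have h : (∑ v, c v • linkMatrix (σ v)).transpose = ∑ v, c v • linkMatrix (σ v) := by
        rw [Matrix.transpose_sum]
        refine Finset.sum_congr rfl fun v _ => ?_
        rw [Matrix.transpose_smul, linkMatrix_isSymm]
      rw [Matrix.IsHermitian, Matrix.conjTranspose_eq_transpose_of_trivial,
        ← Matrix.transpose_map, h]
    · rw [hmap, star_trivial, Matrix.sum_mulVec, dotProduct_sum]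
      refine Finset.sum_pos (fun v _ => ?_) Finset.univ_nonempty
      rw [Matrix.smul_mulVec, dotProduct_smul, smul_eq_mul]
      exact mul_pos (by exact_mod_cast hc v) (linkMatrix_posDef (hinj v) hx)

/-- For an `l`-edge-connected hypergraph, the labels of a product of GHZ states contain diagonal
sets whose size grows with exponent `l`. -/
theorem IsEdgeConnected.exists_isDiagonalSet [Nonempty V] {H : MultiHypergraph V E} {l : ℕ}
    (hl : H.IsEdgeConnected l) (hne : ∀ e, ∃ v, H.Inc v e)
    (hdeg : ∀ v, ∃ T : Finset E, T.card = l ∧ ∀ e ∈ T, H.Inc v e) :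
    ∃ c : ℕ, ∀ a : ℕ, ∃ D : ℕ, ∀ N : ℕ, ∃ S : Finset (Fin N → E → (Fin (a + c) → Fin 2)),
      IsDiagonalSet (fun v (α : Fin N → E → (Fin (a + c) → Fin 2)) n
        (e : {e // H.Inc v e}) => α n e) (S : Set (Fin N → E → (Fin (a + c) → Fin 2))) ∧
      2 ^ (a * l * N) ≤ (N + 1) ^ D * S.card := by
  classical
  choose T cT hT using hdeg
  let v₀ : V := Classical.arbitrary V
  obtain ⟨M, hlocal, hpos, hsep⟩ := hl.exists_matrix hne (hT v₀) (cT v₀) hT cT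
  obtain ⟨u, hu, hu0, huZ⟩ := H.exists_tight M hlocal hpos (hT v₀)
  obtain ⟨B, hB, hBinj⟩ := exists_integer_solutions M hpos (T v₀)
  obtain ⟨C, hC⟩ := B.exists_abs_mulVec_le
  -- Parameters below 2^a give entries of absolute value at most C·2^a. Since 2C + 1 < 2^(2C+1),
  -- this many extra bits hold them; the overhead does not depend on `a`.
  refine ⟨2 * C + 1, fun a => ?_⟩
  set L := Fin (a + (2 * C + 1)) → Fin 2 with hL
  have hcardL : Fintype.card L = 2 ^ (a + (2 * C + 1)) := by simp [hL]
  let g : L → ℤ := fun y => (Fintype.equivFin L y : ℕ) - (C * 2 ^ a : ℕ)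
  have hg : Function.Injective g := by
    intro x y h
    have h1 : ((Fintype.equivFin L x : ℕ) : ℤ) = (Fintype.equivFin L y : ℕ) := by
      simpa [g] using h
    exact (Fintype.equivFin L).injective (Fin.ext (by exact_mod_cast h1))
  have hgsurj : ∀ z : ℤ, |z| ≤ C * 2 ^ a → ∃ y, g y = z := by
    intro z hz
    obtain ⟨h1, h2⟩ := abs_le.1 hz
    have h3 : 2 * C + 1 < 2 ^ (2 * C + 1) := Nat.lt_two_pow_self
    have h4 : (2 * C + 1) * 2 ^ a ≤ 2 ^ (a + (2 * C + 1)) := by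
      rw [pow_add, mul_comm]
      exact Nat.mul_le_mul_left _ h3.le
    have h5 : 1 ≤ 2 ^ a := Nat.one_le_two_pow
    have h6 : ((2 * C + 1) * 2 ^ a : ℤ) ≤ 2 ^ (a + (2 * C + 1)) := by exact_mod_cast h4
    have h7 : (1 : ℤ) ≤ 2 ^ a := by exact_mod_cast h5
    have hlt : (z + (C * 2 ^ a : ℕ)).toNat < Fintype.card L := by
      rw [hcardL]
      zify
      rw [Int.toNat_of_nonneg (by linarith)]
      linarith
    refine ⟨(Fintype.equivFin L).symm ⟨_, hlt⟩, ?_⟩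
    simp only [g, Equiv.apply_symm_apply]
    rw [Int.toNat_of_nonneg (by push_cast; linarith)]
    ring
  let Z : Finset (E → L) :=
    Finset.univ.filter fun x => ∀ e ∉ T v₀, M.mulVec (fun e => g (x e)) e = 0
  have hZcard : 2 ^ (a * l) ≤ Z.card := by
    have hs : ∀ s : {e // e ∈ T v₀} → Fin (2 ^ a), ∃ x : E → L,
        ∀ e, g (x e) = B.mulVec (fun i => ((s i : ℕ) : ℤ)) e := by
      intro s
      have h := fun e => hgsurj _ (by
        have := hC (2 ^ a) (fun i => ((s i : ℕ) : ℤ)) (fun i => by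
          rw [abs_of_nonneg (by positivity)]
          exact_mod_cast (s i).2.le) e
        exact_mod_cast this)
      choose x hx using h
      exact ⟨x, hx⟩
    choose X hX using hs
    have hXinj : Function.Injective X := by
      intro s t hst
      have h : B.mulVec (fun i => ((s i : ℕ) : ℤ)) = B.mulVec (fun i => ((t i : ℕ) : ℤ)) := by
        funext e
        rw [← hX, ← hX, hst]
      funext i
      have := congrFun (hBinj h) i
      exact Fin.ext (by exact_mod_cast this)
    calc 2 ^ (a * l) = Fintype.card ({e // e ∈ T v₀} → Fin (2 ^ a)) := by
          simp [cT, pow_mul]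
      _ = (Finset.univ.image X).card := by
          rw [Finset.card_image_of_injective _ hXinj, Finset.card_univ]
      _ ≤ Z.card := Finset.card_le_card fun x hx => by
          obtain ⟨s, -, rfl⟩ := Finset.mem_image.1 hx
          refine Finset.mem_filter.2 ⟨Finset.mem_univ _, fun e he => ?_⟩
          rw [show (fun e => g (X s e)) = _ from funext (hX s)]
          exact hB _ e he
  let r : ∀ v, (E → L) → ({e // H.Inc v e} → L) := fun v x e => x e
  -- Zero is a filler at edges not incident with `v`, on which `u v` does not depend.
  let u' : ∀ v, ({e // H.Inc v e} → L) → ℝ := fun v y =>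
    u v fun e => if h : H.Inc v e then g (y ⟨e, h⟩) else 0
  have hu' : ∀ v x, u' v (r v x) = u v fun e => g (x e) := by
    intro v x
    refine hu v fun e he => ?_
    exact dif_pos he
  refine ⟨∑ v, Fintype.card ({e // H.Inc v e} → L), fun N => ?_⟩
  obtain ⟨S, hS, hcard⟩ := exists_isDiagonalSet_of_tight r u' Z
    (fun x => by simp only [hu']; exact hu0 _)
    (fun x => by simp only [hu', huZ, Z, Finset.mem_filter, Finset.mem_univ, true_and])
    (fun v x hx y hy h => by
      have hx := (Finset.mem_filter.1 (Finset.mem_coe.1 hx)).2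
      have hy := (Finset.mem_filter.1 (Finset.mem_coe.1 hy)).2
      have h0 := hsep v ((fun e => g (x e)) - fun e => g (y e)) (fun e he => by
        have : x e = y e := congrFun h ⟨e, hT v e he⟩
        simp [this]) (fun e he => by
        rw [Matrix.mulVec_sub, Pi.sub_apply, hx e he, hy e he, sub_zero])
      exact funext fun e => hg (sub_eq_zero.1 (congrFun h0 e))) N
  refine ⟨S, hS, le_trans ?_ hcard⟩
  rw [pow_mul]
  exact Nat.pow_le_pow_left hZcard N

end MultiHypergraph

/-! ### Edge-connectivity, cuts and degrees -/

namespace MultiHypergraph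

variable {V E : Type*}

theorem IsEdgeConnected.mono {H : MultiHypergraph V E} {l m : ℕ} (h : H.IsEdgeConnected m)
    (hlm : l ≤ m) : H.IsEdgeConnected l :=
  fun F hF => h F (hF.trans_le (by exact_mod_cast hlm))

theorem edgeConnectivity_eq_top_of_subsingleton [Subsingleton V] (H : MultiHypergraph V E) :
    H.edgeConnectivity = ⊤ := by
  have h : ∀ l, H.IsEdgeConnected l := fun l F _ x y => by
    rw [Subsingleton.elim x y]
  refine ENat.eq_top_iff_forall_ge.2 fun l => ?_
  exact le_iSup₂_of_le (f := fun (l : ℕ) (_ : H.IsEdgeConnected l) => (l : ℕ∞)) l (h l) le_rfl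

/-- With finitely many edges and at least two vertices, the edge-connectivity is attained. -/
theorem exists_edgeConnectivity_eq [Finite E] [Nontrivial V] (H : MultiHypergraph V E) :
    ∃ l : ℕ, H.edgeConnectivity = l ∧ H.IsEdgeConnected l ∧ ¬ H.IsEdgeConnected (l + 1) := by
  classical
  have hex : ∃ l, ¬ H.IsEdgeConnected l := by
    refine ⟨(Set.univ : Set E).ncard + 1, fun h => ?_⟩
    obtain ⟨x, y, hxy⟩ := exists_pair_ne V
    have hr := h Set.univ (by
      rw [← Set.Finite.cast_ncard_eq Set.finite_univ]
      exact_mod_cast Nat.lt_succ_self _) x y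
    rcases hr.cases_head with h1 | ⟨_, ⟨e, -⟩, -⟩
    · exact hxy h1
    · exact e.2 trivial
  obtain ⟨l, hl⟩ : ∃ l, Nat.find hex = l + 1 := by
    refine Nat.exists_eq_succ_of_ne_zero fun h0 => ?_
    exact (h0 ▸ Nat.find_spec hex : ¬ H.IsEdgeConnected 0) fun F hF => absurd hF (by simp)
  have h1 : H.IsEdgeConnected l := not_not.1 (Nat.find_min hex (by omega))
  have h2 : ¬ H.IsEdgeConnected (l + 1) := hl ▸ Nat.find_spec hex
  refine ⟨l, le_antisymm (iSup₂_le fun m hm => ?_) ?_, h1, h2⟩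
  · by_contra! hlt
    exact h2 (hm.mono (by exact_mod_cast hlt))
  · exact le_iSup₂_of_le (f := fun (l : ℕ) (_ : H.IsEdgeConnected l) => (l : ℕ∞)) l h1 le_rfl

/-- A hypergraph that is not `(l + 1)`-edge-connected has a cut with at most `l` edges. -/
theorem exists_cut [Finite E] {H : MultiHypergraph V E} {l : ℕ}
    (h : ¬ H.IsEdgeConnected (l + 1)) :
    ∃ (F : Finset E) (P : Set V) (p q : V), F.card ≤ l ∧ p ∈ P ∧ q ∉ P ∧
      ∀ i ∈ P, ∀ j ∉ P, ∀ e, H.Inc i e → H.Inc j e → e ∈ F := by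
  simp only [IsEdgeConnected, Connected, not_forall] at h
  obtain ⟨F, hF, x, y, hxy⟩ := h
  refine ⟨F.toFinite.toFinset, {v | Relation.ReflTransGen
    (fun u v => ∃ e : {e : E // e ∉ F}, (H.deleteEdges F).Inc u e ∧ (H.deleteEdges F).Inc v e) x v},
    x, y, ?_, Relation.ReflTransGen.refl, hxy, fun i hi j hj e hei hej => ?_⟩
  · rw [F.toFinite.encard_eq_coe_toFinset_card] at hF
    exact Nat.lt_succ_iff.1 (by exact_mod_cast hF)
  · rw [Set.Finite.mem_toFinset]
    by_contra he
    exact hj (Relation.ReflTransGen.tail hi ⟨⟨e, he⟩, hei, hej⟩)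

/-- Every vertex of an `l`-edge-connected hypergraph is incident with at least `l` edges. -/
theorem IsEdgeConnected.exists_card_eq [Finite E] [Nontrivial V] {H : MultiHypergraph V E} {l : ℕ}
    (h : H.IsEdgeConnected l) (v : V) : ∃ T : Finset E, T.card = l ∧ ∀ e ∈ T, H.Inc v e := by
  have hfin := Set.toFinite {e | H.Inc v e}
  have hle : l ≤ hfin.toFinset.card := by
    by_contra! hlt
    obtain ⟨w, hw⟩ := exists_ne v
    have hr := h {e | H.Inc v e} (by
      rw [hfin.encard_eq_coe_toFinset_card]; exact_mod_cast hlt) v w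
    rcases hr.cases_head with h1 | ⟨_, ⟨e, he, -⟩, -⟩
    · exact hw h1.symm
    · exact e.2 he
  obtain ⟨T, hT, cT⟩ := Finset.exists_subset_card_eq hle
  exact ⟨T, cT, fun e he => by simpa using hT he⟩

/-- The hypergraph without the edges that are incident with no vertex. -/
def dropEmptyEdges (H : MultiHypergraph V E) : MultiHypergraph V {e : E // ∃ v, H.Inc v e} where
  Inc v e := H.Inc v e

theorem IsEdgeConnected.dropEmptyEdges {H : MultiHypergraph V E} {l : ℕ}
    (h : H.IsEdgeConnected l) : H.dropEmptyEdges.IsEdgeConnected l := by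
  intro F hF x y
  have hr := h (Subtype.val '' F) (by rwa [Subtype.val_injective.encard_image]) x y
  refine Relation.ReflTransGen.mono ?_ _ _ hr
  rintro u v ⟨⟨e, he⟩, hu, hv⟩
  exact ⟨⟨⟨e, u, hu⟩, fun h => he ⟨_, h, rfl⟩⟩, hu, hv⟩

end MultiHypergraph

/-! ### Bounds and conversions for GHZ states -/

section States

variable {k : ℕ} {E : Type*} [Fintype E]

theorem partyPow_ghz (k r n : ℕ) : partyPow (ghz k r) n =
    ∑ β : Fin n → Fin r, PiTensorProduct.tprod ℂ fun _ : Fin k => powBasis (Fin r) n β := by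
  have h : ghz k r = ∑ a : Fin r, PiTensorProduct.tprod ℂ fun _ => Pi.basisFun ℂ (Fin r) a := by
    simp only [ghz, Pi.basisFun_apply]
  rw [h]
  exact partyPow_sum_basisFun (fun (_ : Fin k) (a : Fin r) => a) n

open Classical in
theorem MultiHypergraph.ghzState_eq (H : MultiHypergraph (Fin k) E) (r : ℕ) :
    H.ghzState r = ∑ a : E → Fin r, PiTensorProduct.tprod ℂ fun j =>
      Pi.basisFun ℂ ({e : E // H.Inc j e} → Fin r) fun e => a e.1 := by
  rw [MultiHypergraph.ghzState]
  refine Finset.sum_congr rfl fun a _ => congrArg _ (funext fun j => ?_)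
  rw [Pi.basisFun_apply]

open Classical in
/-- Empty edges contribute only a scalar factor to the tensor powers of a product of GHZ states. -/
theorem MultiHypergraph.exists_partyPow_ghzState_eq (H : MultiHypergraph (Fin k) E) (m : ℕ) :
    ∃ c : ℂ, c ≠ 0 ∧ partyPow (H.ghzState 2) m =
      c • ∑ α : Fin m → {e : E // ∃ v, H.Inc v e} → Fin 2,
        PiTensorProduct.tprod ℂ fun j => powBasis ({e : E // H.Inc j e} → Fin 2) m
          fun l e => α l ⟨e.1, j, e.2⟩ := by
  have h : H.ghzState 2 = (Fintype.card ({e : E // ¬ ∃ v, H.Inc v e} → Fin 2) : ℂ) •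
      ∑ a : {e : E // ∃ v, H.Inc v e} → Fin 2, PiTensorProduct.tprod ℂ fun j =>
        Pi.basisFun ℂ ({e : E // H.Inc j e} → Fin 2) fun e => a ⟨e.1, j, e.2⟩ := by
    rw [H.ghzState_eq,
      ← (Equiv.piEquivPiSubtypeProd (fun e => ∃ v, H.Inc v e) fun _ => Fin 2).symm.sum_comp,
      Fintype.sum_prod_type_right, Nat.cast_smul_eq_nsmul]
    refine Finset.sum_eq_card_nsmul fun b _ => Finset.sum_congr rfl fun a _ => ?_
    congr 1; funext j; congr 1; funext e
    exact dif_pos ⟨j, e.2⟩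
  refine ⟨(Fintype.card ({e : E // ¬ ∃ v, H.Inc v e} → Fin 2) : ℂ) ^ m, pow_ne_zero m ?_, ?_⟩
  · exact_mod_cast Fintype.card_ne_zero
  · rw [h]
    exact partyPow_smul_sum_basisFun _
      (fun j (a : {e : E // ∃ v, H.Inc v e} → Fin 2) (e : {e : E // H.Inc j e}) =>
        a ⟨e.1, j, e.2⟩) m

open Classical in
theorem MultiHypergraph.partyPow_ghzState (H : MultiHypergraph (Fin k) E) (m : ℕ) :
    partyPow (H.ghzState 2) m = ∑ α : Fin m × E → Fin 2,
      PiTensorProduct.tprod ℂ fun j => powBasis ({e : E // H.Inc j e} → Fin 2) m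
        fun t e => α (t, e.1) := by
  rw [H.ghzState_eq, partyPow_sum_basisFun, ← (Equiv.curry (Fin m) E (Fin 2)).sum_comp]
  rfl

open Classical in
/-- A cut bounds the number of GHZ states that can be obtained. -/
theorem le_mul_of_SLOCC_ghz {H : MultiHypergraph (Fin k) E} {l : ℕ}
    (h : ¬ H.IsEdgeConnected (l + 1)) {m n : ℕ}
    (hS : SLOCC (partyPow (H.ghzState 2) m) (partyPow (ghz k 2) n)) : n ≤ m * l := by
  obtain ⟨F, P, p, q, hF, hp, hq, hcut⟩ := MultiHypergraph.exists_cut h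
  rw [H.partyPow_ghzState, partyPow_ghz] at hS
  have h1 := SLOCC.card_le_pow (fun j (α : Fin m × E → Fin 2) =>
      powBasis ({e : E // H.Inc j e} → Fin 2) m fun t e => α (t, e.1))
    (fun j => {x : Fin m × E | H.Inc j x.2})
    (fun j α α' hα => congrArg _ (funext fun t => funext fun e => hα (t, e.1) e.2))
    (fun _ => powBasis (Fin 2) n) P hp hq (Finset.univ ×ˢ F)
    (fun i hi j hj x hx => by simpa using hcut i hi j hj x.2 hx.1 hx.2) hS
  simp only [Fintype.card_pi, Fintype.card_fin, Finset.prod_const, Finset.card_univ,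
    Finset.card_product] at h1
  exact ((Nat.pow_le_pow_iff_right one_lt_two).1 h1).trans (Nat.mul_le_mul_left m hF)

/-- Diagonal sets of labels yield GHZ states. -/
theorem MultiHypergraph.SLOCC_ghz_of_isDiagonalSet [Nonempty (Fin k)]
    {H : MultiHypergraph (Fin k) E} {N b n : ℕ}
    {S : Finset (Fin N → {e : E // ∃ v, H.Inc v e} → (Fin b → Fin 2))}
    (hS : IsDiagonalSet (fun v (α : Fin N → {e : E // ∃ v, H.Inc v e} → (Fin b → Fin 2)) t
      (e : {e // H.dropEmptyEdges.Inc v e}) => α t e)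
      (S : Set (Fin N → {e : E // ∃ v, H.Inc v e} → (Fin b → Fin 2))))
    (hn : 2 ^ n ≤ S.card) :
    SLOCC (partyPow (H.ghzState 2) (N * b)) (partyPow (ghz k 2) n) := by
  classical
  obtain ⟨c, hc, h⟩ := H.exists_partyPow_ghzState_eq (N * b)
  rw [h, partyPow_ghz]
  -- The `N * b` copies form `N` blocks of `b`; in each block an edge carries one `b`-bit label.
  let e : (Fin (N * b) → {e : E // ∃ v, H.Inc v e} → Fin 2) ≃
      (Fin N → {e : E // ∃ v, H.Inc v e} → (Fin b → Fin 2)) :=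
    { toFun := fun α t i s => α (finProdFinEquiv (t, s)) i
      invFun := fun β x i => β (finProdFinEquiv.symm x).1 i (finProdFinEquiv.symm x).2
      left_inv := fun α => funext fun x => funext fun i =>
        congrArg (fun y => α y i) (finProdFinEquiv.apply_symm_apply x)
      right_inv := fun β => by funext t i s; simp }
  have hS' := hS.preimage (r' := fun j α (x : Fin (N * b)) (i : {i : E // H.Inc j i}) =>
    α x ⟨i.1, j, i.2⟩) e fun j α β => by
      constructor
      · intro h
        funext x i
        have := congrFun (congrFun (congrFun h (finProdFinEquiv.symm x).1) ⟨⟨i.1, j, i.2⟩, i.2⟩)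
          (finProdFinEquiv.symm x).2
        rw [← finProdFinEquiv.apply_symm_apply x]
        exact this
      · intro h
        funext t i s
        exact congrFun (congrFun h (finProdFinEquiv (t, s))) ⟨i.1.1, i.2⟩
  obtain ⟨g⟩ : Nonempty ((Fin n → Fin 2) ↪ S) :=
    Function.Embedding.nonempty_of_card_le (by simpa using hn)
  refine SLOCC.of_isDiagonalSet (fun j => powBasis ({e : E // H.Inc j e} → Fin 2) (N * b))
    (fun j α x (i : {i : E // H.Inc j i}) => α x ⟨i.1, j, i.2⟩) hc (fun β => e.symm (g β))
    (fun β β' hβ => g.injective (Subtype.ext (e.symm.injective hβ))) (hS'.subset ?_)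
    (fun _ => powBasis (Fin 2) n)
  rintro _ ⟨β, rfl⟩
  simp

/-- A single party can produce any state from nothing. -/
theorem SLOCC_zero_ghz_one (H : MultiHypergraph (Fin 1) E) (n : ℕ) :
    SLOCC (partyPow (H.ghzState 2) 0) (partyPow (ghz 1 2) n) := by
  classical
  obtain ⟨c, hc, h⟩ := H.exists_partyPow_ghzState_eq 0
  -- With one party the whole sum is a single vector, matched to the unique label of zero copies.
  have h2 : partyPow (ghz 1 2) n = ∑ _x : Unit, PiTensorProduct.tprod ℂ fun _ : Fin 1 =>
      ∑ β, powBasis (Fin 2) n β := by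
    have hup : ∀ x : ⨂[ℂ]^n (Fin 2 → ℂ),
        Function.update (fun _ : Fin 1 => (0 : ⨂[ℂ]^n (Fin 2 → ℂ))) 0 x = fun _ => x :=
      fun x => by funext i; rw [Subsingleton.elim i 0, Function.update_self]
    have hsum := (PiTensorProduct.tprod ℂ (s := fun _ : Fin 1 => ⨂[ℂ]^n (Fin 2 → ℂ))).map_update_sum
      Finset.univ (0 : Fin 1) (fun β => powBasis (Fin 2) n β) (fun _ => 0)
    simp only [hup] at hsum
    rw [partyPow_ghz, ← hsum]
    simp
  rw [h, h2]
  exact SLOCC.of_isDiagonalSet (fun j => powBasis ({e : E // H.Inc j e} → Fin 2) 0)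
    (fun j (α : Fin 0 → {e : E // ∃ v, H.Inc v e} → Fin 2) x (i : {i : E // H.Inc j i}) =>
      α x ⟨i.1, j, i.2⟩) hc (fun (_ : Unit) x => x.elim0) (fun _ _ _ => rfl)
    ⟨fun j x _ y _ _ => Subsingleton.elim x y, fun x _ => ⟨(), Subsingleton.elim _ x⟩⟩
    (fun _ _ => ∑ β, powBasis (Fin 2) n β)

end States

/-! ### From achievable conversions to the rate -/

section Rate

/-- The asymptotics of the cost, from the achievable conversions. -/
theorem eventually_div_lt_of_achievable {f : ℕ → ℝ≥0∞} {l c : ℕ} (hl : 0 < l)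
    (h : ∀ a : ℕ, ∃ D : ℕ, ∀ N n : ℕ, 2 ^ n * (N + 1) ^ D ≤ 2 ^ (a * l * N) →
      f n ≤ ((N * (a + c) : ℕ) : ℝ≥0∞)) {b : ℝ≥0∞} (hb : 1 / (l : ℝ≥0∞) < b) :
    ∀ᶠ n : ℕ in atTop, f n / n < b := by
  obtain ⟨r, hr, hrb⟩ := ENNReal.lt_iff_exists_nnreal_btwn.1 hb
  have hlr : (1 / l : ℝ) < r := by
    have : ((1 / l : NNReal) : ℝ≥0∞) < r := by
      rw [ENNReal.coe_div (by positivity)]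
      simpa using hr
    exact_mod_cast this
  have hl0 : (0 : ℝ) < l := by exact_mod_cast hl
  -- The `- 1` gives up one of the `a * l` bits per block to absorb (N + 1)^D ≤ 2^N.
  have hlim : Tendsto (fun a : ℕ => ((a + c : ℝ)) / (a * l - 1)) atTop (𝓝 (1 / l)) := by
    have h1 : Tendsto (fun a : ℕ => (1 + c * (a : ℝ)⁻¹) / (l - (a : ℝ)⁻¹)) atTop
        (𝓝 ((1 + c * 0) / (l - 0))) := by
      refine Tendsto.div ?_ ?_ (by simpa using hl0.ne')
      · exact (tendsto_inv_atTop_nhds_zero_nat.const_mul _).const_add _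
      · exact tendsto_inv_atTop_nhds_zero_nat.const_sub _
    simp only [mul_zero, add_zero, sub_zero] at h1
    refine h1.congr' ?_
    filter_upwards [eventually_gt_atTop 0] with a ha
    have ha : (a : ℝ) ≠ 0 := by positivity
    rw [← mul_div_mul_left _ _ ha]
    congr 1 <;> field_simp
  obtain ⟨a, har, ha⟩ := ((hlim.eventually_lt_const hlr).and (eventually_ge_atTop 2)).exists
  obtain ⟨D, hD⟩ := h a
  obtain ⟨p, hp⟩ : ∃ p, a * l = p + 1 + 1 := ⟨a * l - 2, by have := Nat.mul_le_mul ha hl; omega⟩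
  have hpow : ∀ᶠ N : ℕ in atTop, (N + 1) ^ D ≤ 2 ^ N := by
    have h1 := (tendsto_pow_const_div_const_pow_of_one_lt D (one_lt_two (α := ℝ))).comp
      (tendsto_add_atTop_nat 1)
    filter_upwards [h1.eventually_lt_const (show (0 : ℝ) < 1 / 2 by norm_num)] with N hN
    simp only [Function.comp_apply] at hN
    rw [div_lt_iff₀ (by positivity), pow_succ] at hN
    have h2 : ((N + 1 : ℕ) : ℝ) ^ D < 2 ^ N := by linarith
    exact_mod_cast h2.le
  have hN : Tendsto (fun n : ℕ => n / (p + 1) + 1) atTop atTop :=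
    (tendsto_add_atTop_nat 1).comp (Nat.tendsto_div_const_atTop (Nat.succ_ne_zero p))
  have hlim2 : Tendsto (fun n : ℕ => ((a + c : ℝ)) / (a * l - 1) + (a + c) * (n : ℝ)⁻¹) atTop
      (𝓝 ((a + c : ℝ) / (a * l - 1) + (a + c) * 0)) :=
    (tendsto_inv_atTop_nhds_zero_nat.const_mul _).const_add _
  rw [mul_zero, add_zero] at hlim2
  filter_upwards [hN.eventually hpow, hlim2.eventually_lt_const har, eventually_gt_atTop 0]
    with n h1 h2 h3
  refine lt_of_le_of_lt ?_ hrb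
  set N := n / (p + 1) + 1 with hNdef
  have h4 : n ≤ (p + 1) * N := (Nat.lt_mul_div_succ n (Nat.succ_pos p)).le
  have h5 := hD N n (by
    calc 2 ^ n * (N + 1) ^ D ≤ 2 ^ ((p + 1) * N) * 2 ^ N :=
          Nat.mul_le_mul (Nat.pow_le_pow_right two_pos h4) h1
      _ = 2 ^ (a * l * N) := by rw [hp, ← pow_add]; ring_nf)
  have h6 : ((N * (a + c) : ℕ) : ℝ) ≤ r * n := by
    have h7 : (a * l - 1 : ℝ) = p + 1 := by
      have : (a * l : ℝ) = p + 1 + 1 := by exact_mod_cast hp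
      linarith
    have h8 : (N : ℝ) ≤ n / (p + 1) + 1 := by
      have := Nat.cast_div_le (α := ℝ) (m := n) (n := p + 1)
      rw [hNdef]
      push_cast at this ⊢
      linarith
    have hn0 : (0 : ℝ) < n := by exact_mod_cast h3
    rw [h7] at h2
    push_cast
    calc (N : ℝ) * (a + c) ≤ (n / (p + 1) + 1) * (a + c) :=
          mul_le_mul_of_nonneg_right h8 (by positivity)
      _ = ((a + c : ℝ) / (p + 1) + (a + c) * (n : ℝ)⁻¹) * n := by field_simp
      _ ≤ r * n := mul_le_mul_of_nonneg_right h2.le hn0.le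
  rw [ENNReal.div_le_iff (by exact_mod_cast h3.ne') (ENNReal.natCast_ne_top n)]
  refine h5.trans ?_
  exact_mod_cast h6

end Rate

theorem mainTheorem1 {k : ℕ} (hk : 1 ≤ k) {E : Type*} [Fintype E]
    (H : MultiHypergraph (Fin k) E) :
    Tendsto (fun n : ℕ => sloccCost (H.ghzState 2) (ghz k 2) n / n) atTop
        (𝓝 (1 / (H.edgeConnectivity : ℝ≥0∞))) ∧
      sloccRate (H.ghzState 2) (ghz k 2) = 1 / (H.edgeConnectivity : ℝ≥0∞) := by
  suffices h : Tendsto (fun n : ℕ => sloccCost (H.ghzState 2) (ghz k 2) n / n) atTop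
      (𝓝 (1 / (H.edgeConnectivity : ℝ≥0∞))) from ⟨h, h.limUnder_eq⟩
  obtain rfl | hk2 := hk.eq_or_lt
  · have h0 : ∀ n, sloccCost (H.ghzState 2) (ghz 1 2) n = 0 := fun n =>
      le_antisymm (iInf₂_le_of_le 0 (SLOCC_zero_ghz_one H n) (by simp)) bot_le
    simp [h0, H.edgeConnectivity_eq_top_of_subsingleton]
  · classical
    have : Nontrivial (Fin k) := Fin.nontrivial_iff_two_le.2 hk2
    obtain ⟨l, hl, h1, h2⟩ := H.exists_edgeConnectivity_eq
    rw [hl]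
    simp only [ENat.toENNReal_coe]
    refine tendsto_order.2 ⟨fun b hb => ?_, fun b hb => ?_⟩
    · filter_upwards [eventually_gt_atTop 0] with n hn
      refine hb.trans_le ?_
      rw [ENNReal.le_div_iff_mul_le (.inl (by exact_mod_cast hn.ne'))
        (.inl (ENNReal.natCast_ne_top n))]
      refine le_iInf₂ fun m hm => ?_
      have h3 := le_mul_of_SLOCC_ghz h2 hm
      -- For `l = 0` and `n > 0` no `m` is feasible, by `h3`.
      have hl0 : l ≠ 0 := by rintro rfl; omega
      rw [one_div, mul_comm, ← div_eq_mul_inv]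
      refine ENNReal.div_le_of_le_mul ?_
      exact_mod_cast h3
    -- For `l = 0` the claimed limit is ∞, which no `b` exceeds.
    · have hl0 : 0 < l := by
        refine Nat.pos_of_ne_zero ?_
        rintro rfl
        simp at hb
      obtain ⟨c, hc⟩ := h1.dropEmptyEdges.exists_isDiagonalSet (fun e => e.2)
        h1.dropEmptyEdges.exists_card_eq
      refine eventually_div_lt_of_achievable (c := c) hl0 (fun a => ?_) hb
      obtain ⟨D, hD⟩ := hc a
      refine ⟨D, fun N n hn => ?_⟩
      obtain ⟨S, hS, hcard⟩ := hD N
      refine iInf₂_le (N * (a + c)) (MultiHypergraph.SLOCC_ghz_of_isDiagonalSet hS ?_)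
      have h3 := hn.trans hcard
      rw [mul_comm] at h3
      exact Nat.le_of_mul_le_mul_left h3 (by positivity)
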